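/- **Theorem 4.2 (genericity of the upper bound).** An element of $2V$ is a bijection of the square represented by a tree-pair diagram $(T_+,\pi,T_-)$: two finite rooted binary trees with the same number of leaves, whose carets are each of vertical type (halving a rectangle into left and right parts) or horizontal type (halving it into bottom and top parts), and a bijection $\pi$ between their leaves; the dyadic rectangle of each leaf of $T_+$ is mapped affinely, preserving the orientation of each coordinate, onto the rectangle of the corresponding leaf of $T_-$. (The square is $C\times C$, with $C=\{0,1\}^{\mathbb N}$ the Cantor set of binary expansions.) A diagram has $n$ carets if each of its trees has $n$ carets. Let $H_n$ be the set of elements of $2V$ that are represented by a diagram with $n$ carets and by no diagram with fewer carets. Then every $H_n$ is finite and non-empty, and there are constants $C>0$ and $0<r<1$ such that for every finite generating set $S$ of $2V$, with $d=|S|$, and every $n\ge 0$, $$\left|\frac{\#\{g\in H_n : |g|_S> n\log_{2d} n\}}{\#H_n}-1\right|\le C\,r^n ,$$ where $|g|_S$ is the least length of a word in the elements of $S$ and their inverses that represents $g$ (and $n\log_{2d} n$ is read as $0$ for $n=0$). That is, the fraction of elements of $H_n$ with word length greater than $n\log_{2d}n$ tends to $1$ exponentially fast. The same holds for every finite subset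 $S$ of $2V$, if $|g|_S=\infty$ for those $g$ that are not products of elements of $S$ and their inverses. -/

import Mathlib

namespace HigherThompson

/-- The Cantor set of infinite binary sequences: the unit interval, with every dyadic
cut point counted twice, once as a right end and once as a left end. -/
abbrev Cantor : Type := ℕ → Bool

/-- Put the digit `b` in front of a sequence. -/
def cons (b : Bool) (x : Cantor) : Cantor
  | 0 => b
  | n + 1 => x n

/-- The Cantor square, first coordinate horizontal, second coordinate vertical. -/
abbrev Square : Type := Cantor × Cantor

/-- Cutting the interval in half: `inl` is the lower half (first digit `false`),
`inr` the upper half (first digit `true`). -/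
def halves : Cantor ⊕ Cantor ≃ Cantor where
  toFun := Sum.elim (cons false) (cons true)
  invFun x := if x 0 then Sum.inr (fun n => x (n + 1)) else Sum.inl (fun n => x (n + 1))
  left_inv := by rintro (x | x) <;> simp [cons]
  right_inv x := by
    funext n
    cases h : x 0 <;> cases n <;> simp [h, cons]

/-- A vertical subdivision of the square: `inl` is the left half, `inr` the right half,
each identified with the whole square by the orientation preserving affine map. -/
def vertHalves : Square ⊕ Square ≃ Square :=
  (Equiv.sumProdDistrib Cantor Cantor Cantor).symm.trans
    (Equiv.prodCongr halves (Equiv.refl Cantor))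

/-- A horizontal subdivision of the square: `inl` is the bottom half, `inr` the top half. -/
def horizHalves : Square ⊕ Square ≃ Square :=
  (Equiv.prodSumDistrib Cantor Cantor Cantor).symm.trans
    (Equiv.prodCongr (Equiv.refl Cantor) halves)

/-- Finite rooted binary trees with two types of carets. For a vertical caret the children
are the left and the right half, for a horizontal caret the bottom and the top half. -/
inductive Tree : Type
  | leaf : Tree
  | vert (l r : Tree) : Tree
  | horiz (l r : Tree) : Tree

namespace Tree

/-- The number of carets (interior vertices) of a tree. -/
def carets : Tree → ℕ
  | leaf => 0
  | vert l r => l.carets + r.carets + 1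
  | horiz l r => l.carets + r.carets + 1

/-- The leaves of a tree. -/
def Leaf : Tree → Type
  | leaf => Unit
  | vert l r => l.Leaf ⊕ r.Leaf
  | horiz l r => l.Leaf ⊕ r.Leaf

/-- The dyadic partition of the square given by a tree: for each leaf `a`, the map
`x ↦ T.partition (a, x)` is the affine identification of the square with the dyadic
rectangle of the leaf `a`. -/
def partition : (T : Tree) → T.Leaf × Square ≃ Square
  | leaf => Equiv.punitProd Square
  | vert l r => (Equiv.sumProdDistrib l.Leaf r.Leaf Square).trans
      ((Equiv.sumCongr l.partition r.partition).trans vertHalves)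
  | horiz l r => (Equiv.sumProdDistrib l.Leaf r.Leaf Square).trans
      ((Equiv.sumCongr l.partition r.partition).trans horizHalves)

end Tree

/-- A tree-pair diagram: two trees and a bijection between their leaves. -/
structure TreePair : Type where
  domain : Tree
  range : Tree
  perm : domain.Leaf ≃ range.Leaf

namespace TreePair

/-- The number of carets of a diagram, that is, of each of its trees (both trees have the
same number of leaves, hence of carets). -/
def carets (D : TreePair) : ℕ := D.domain.carets

/-- The bijection of the square that a diagram represents: each rectangle of the domain
partition is mapped affinely onto the rectangle of the range partition that `perm`
assigns to it. -/
def toPerm (D : TreePair) : Equiv.Perm Square :=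
  D.domain.partition.symm.trans
    ((Equiv.prodCongr D.perm (Equiv.refl Square)).trans D.range.partition)

end TreePair

/-! Helper facts: the maps given by diagrams are closed under composition. -/

/-- `T'` subdivides the rectangles of `T` further, by the trees `U a`. -/
def Subdivides (T : Tree) (U : T.Leaf → Tree) (T' : Tree) : Prop :=
  ∃ e : (Σ a, (U a).Leaf) ≃ T'.Leaf,
    ∀ a b x, T'.partition (e ⟨a, b⟩, x) = T.partition (a, (U a).partition (b, x))

/-- `T'` is a further subdivision of `T`. -/
def Refines (T T' : Tree) : Prop := ∃ U, Subdivides T U T'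

theorem vert_inl (l r : Tree) (a : l.Leaf) (x : Square) :
    (Tree.vert l r).partition (Sum.inl a, x) = vertHalves (Sum.inl (l.partition (a, x))) := rfl

theorem vert_inr (l r : Tree) (a : r.Leaf) (x : Square) :
    (Tree.vert l r).partition (Sum.inr a, x) = vertHalves (Sum.inr (r.partition (a, x))) := rfl

theorem horiz_inl (l r : Tree) (a : l.Leaf) (x : Square) :
    (Tree.horiz l r).partition (Sum.inl a, x) = horizHalves (Sum.inl (l.partition (a, x))) := rfl

theorem horiz_inr (l r : Tree) (a : r.Leaf) (x : Square) :
    (Tree.horiz l r).partition (Sum.inr a, x) = horizHalves (Sum.inr (r.partition (a, x))) := rfl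

theorem subdivides_leaf (T : Tree) : Subdivides Tree.leaf (fun _ => T) T :=
  ⟨Equiv.uniqueSigma (α := Unit) (fun _ => T.Leaf), fun _ _ _ => rfl⟩

theorem refines_of_equiv {T T' : Tree} (e : T.Leaf ≃ T'.Leaf)
    (h : ∀ a x, T'.partition (e a, x) = T.partition (a, x)) : Refines T T' :=
  ⟨fun _ => Tree.leaf,
    (Equiv.sigmaPUnit T.Leaf : (Σ _ : T.Leaf, Unit) ≃ T.Leaf).trans e,
    fun a _ x => h a x⟩

theorem refines_refl (T : Tree) : Refines T T :=
  refines_of_equiv (Equiv.refl _) fun _ _ => rfl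

theorem subdivides_vert {l r l' r' : Tree} {U : (Tree.vert l r).Leaf → Tree}
    (hl : Subdivides l (fun a => U (Sum.inl a)) l')
    (hr : Subdivides r (fun a => U (Sum.inr a)) r') :
    Subdivides (Tree.vert l r) U (Tree.vert l' r') := by
  obtain ⟨e, he⟩ := hl
  obtain ⟨f, hf⟩ := hr
  refine ⟨(Equiv.sumSigmaDistrib (α := l.Leaf) (β := r.Leaf) (fun a => (U a).Leaf)).trans
    (Equiv.sumCongr e f), ?_⟩
  rintro (a | a) b x
  · exact congrArg (fun z => vertHalves (Sum.inl z)) (he a b x)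
  · exact congrArg (fun z => vertHalves (Sum.inr z)) (hf a b x)

theorem subdivides_horiz {l r l' r' : Tree} {U : (Tree.horiz l r).Leaf → Tree}
    (hl : Subdivides l (fun a => U (Sum.inl a)) l')
    (hr : Subdivides r (fun a => U (Sum.inr a)) r') :
    Subdivides (Tree.horiz l r) U (Tree.horiz l' r') := by
  obtain ⟨e, he⟩ := hl
  obtain ⟨f, hf⟩ := hr
  refine ⟨(Equiv.sumSigmaDistrib (α := l.Leaf) (β := r.Leaf) (fun a => (U a).Leaf)).trans
    (Equiv.sumCongr e f), ?_⟩
  rintro (a | a) b x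
  · exact congrArg (fun z => horizHalves (Sum.inl z)) (he a b x)
  · exact congrArg (fun z => horizHalves (Sum.inr z)) (hf a b x)

/-- Trees can be grafted onto the leaves of a tree. -/
theorem exists_subdivides (T : Tree) (U : T.Leaf → Tree) : ∃ T', Subdivides T U T' := by
  induction T with
  | leaf => exact ⟨U (), subdivides_leaf (U ())⟩
  | vert l r hl hr =>
    obtain ⟨l', h⟩ := hl fun a => U (Sum.inl a)
    obtain ⟨r', h'⟩ := hr fun a => U (Sum.inr a)
    exact ⟨_, subdivides_vert h h'⟩
  | horiz l r hl hr =>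
    obtain ⟨l', h⟩ := hl fun a => U (Sum.inl a)
    obtain ⟨r', h'⟩ := hr fun a => U (Sum.inr a)
    exact ⟨_, subdivides_horiz h h'⟩

theorem refines_vert {l r l' r' : Tree} (hl : Refines l l') (hr : Refines r r') :
    Refines (Tree.vert l r) (Tree.vert l' r') := by
  obtain ⟨U, h⟩ := hl
  obtain ⟨W, h'⟩ := hr
  exact ⟨Sum.elim U W, subdivides_vert h h'⟩

theorem refines_horiz {l r l' r' : Tree} (hl : Refines l l') (hr : Refines r r') :
    Refines (Tree.horiz l r) (Tree.horiz l' r') := by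
  obtain ⟨U, h⟩ := hl
  obtain ⟨W, h'⟩ := hr
  exact ⟨Sum.elim U W, subdivides_horiz h h'⟩

theorem refines_trans {T T' T'' : Tree} (h : Refines T T') (h' : Refines T' T'') :
    Refines T T'' := by
  obtain ⟨U, e, he⟩ := h
  obtain ⟨W, f, hf⟩ := h'
  choose V g hg using fun a => exists_subdivides (U a) fun b => W (e ⟨a, b⟩)
  refine ⟨V, (Equiv.sigmaCongrRight fun a => (g a).symm).trans
    ((Equiv.sigmaAssoc fun a b => (W (e ⟨a, b⟩)).Leaf).symm.trans
      ((Equiv.sigmaCongrLeft (β := fun c => (W c).Leaf) e).trans f)), ?_⟩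
  intro a c x
  obtain ⟨⟨b, d⟩, rfl⟩ := (g a).surjective c
  rw [hg, ← he, ← hf]
  simp [Equiv.sigmaAssoc, Equiv.sigmaCongrLeft]

/-- The four quarters do not depend on the order of the two subdivisions. -/
theorem refines_quarters (a b c d : Tree) :
    Refines (Tree.horiz (Tree.vert a b) (Tree.vert c d))
      (Tree.vert (Tree.horiz a c) (Tree.horiz b d)) :=
  refines_of_equiv (Equiv.sumSumSumComm a.Leaf b.Leaf c.Leaf d.Leaf)
    (by rintro ((p | p) | (p | p)) x <;> rfl)

theorem refines_quarters' (a b c d : Tree) :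
    Refines (Tree.vert (Tree.horiz a b) (Tree.horiz c d))
      (Tree.horiz (Tree.vert a c) (Tree.vert b d)) :=
  refines_of_equiv (Equiv.sumSumSumComm a.Leaf b.Leaf c.Leaf d.Leaf)
    (by rintro ((p | p) | (p | p)) x <;> rfl)

theorem exists_refines_vert (T : Tree) : ∃ l r, Refines T (Tree.vert l r) := by
  induction T with
  | leaf => exact ⟨Tree.leaf, Tree.leaf, _, subdivides_leaf _⟩
  | vert l r _ _ => exact ⟨l, r, refines_refl _⟩
  | horiz l r hl hr =>
    obtain ⟨a, b, h⟩ := hl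
    obtain ⟨c, d, h'⟩ := hr
    exact ⟨_, _, refines_trans (refines_horiz h h') (refines_quarters a b c d)⟩

theorem exists_refines_horiz (T : Tree) : ∃ l r, Refines T (Tree.horiz l r) := by
  induction T with
  | leaf => exact ⟨Tree.leaf, Tree.leaf, _, subdivides_leaf _⟩
  | horiz l r _ _ => exact ⟨l, r, refines_refl _⟩
  | vert l r hl hr =>
    obtain ⟨a, b, h⟩ := hl
    obtain ⟨c, d, h'⟩ := hr
    exact ⟨_, _, refines_trans (refines_vert h h') (refines_quarters' a b c d)⟩

/-- Any two dyadic partitions have a common refinement. -/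
theorem exists_common_refinement (S T : Tree) : ∃ R, Refines S R ∧ Refines T R := by
  induction S generalizing T with
  | leaf => exact ⟨T, ⟨_, subdivides_leaf T⟩, refines_refl T⟩
  | vert l r hl hr =>
    obtain ⟨a, b, h⟩ := exists_refines_vert T
    obtain ⟨l', h1, h2⟩ := hl a
    obtain ⟨r', h3, h4⟩ := hr b
    exact ⟨_, refines_vert h1 h3, refines_trans h (refines_vert h2 h4)⟩
  | horiz l r hl hr =>
    obtain ⟨a, b, h⟩ := exists_refines_horiz T
    obtain ⟨l', h1, h2⟩ := hl a
    obtain ⟨r', h3, h4⟩ := hr b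
    exact ⟨_, refines_horiz h1 h3, refines_trans h (refines_horiz h2 h4)⟩

theorem toPerm_apply (D : TreePair) (a : D.domain.Leaf) (x : Square) :
    D.toPerm (D.domain.partition (a, x)) = D.range.partition (D.perm a, x) := by
  simp [TreePair.toPerm]

/-- The diagram of the inverse map. -/
def TreePair.flip (D : TreePair) : TreePair := ⟨D.range, D.domain, D.perm.symm⟩

theorem toPerm_flip (D : TreePair) : D.flip.toPerm = D.toPerm⁻¹ := rfl

theorem exists_refine_range (D : TreePair) {R : Tree} (h : Refines D.range R) :
    ∃ (P : Tree) (σ : P.Leaf ≃ R.Leaf), (TreePair.mk P R σ).toPerm = D.toPerm := by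
  obtain ⟨U, e, he⟩ := h
  obtain ⟨P, g, hg⟩ := exists_subdivides D.domain fun a => U (D.perm a)
  refine ⟨P, g.symm.trans
    ((Equiv.sigmaCongrLeft (β := fun c => (U c).Leaf) D.perm).trans e), ?_⟩
  ext1 z
  obtain ⟨⟨p, x⟩, rfl⟩ := P.partition.surjective z
  obtain ⟨⟨a, b⟩, rfl⟩ := g.surjective p
  rw [toPerm_apply ⟨P, R, _⟩]
  rw [hg, toPerm_apply, ← he]
  simp [Equiv.sigmaCongrLeft]

theorem exists_toPerm_mul (D E : TreePair) : ∃ F : TreePair, F.toPerm = D.toPerm * E.toPerm := by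
  obtain ⟨R, h, h'⟩ := exists_common_refinement E.range D.domain
  obtain ⟨P, σ, hσ⟩ := exists_refine_range E h
  obtain ⟨Q, τ, hτ⟩ := exists_refine_range D.flip (R := R) h'
  refine ⟨⟨P, Q, σ.trans τ.symm⟩, ?_⟩
  rw [eq_comm, toPerm_flip, inv_eq_iff_eq_inv, ← toPerm_flip] at hτ
  rw [hτ, ← hσ]
  ext1 z
  obtain ⟨⟨p, x⟩, rfl⟩ := P.partition.surjective z
  rw [Equiv.Perm.mul_apply, toPerm_apply ⟨P, R, σ⟩, toPerm_apply ⟨P, Q, _⟩]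
  exact (toPerm_apply (TreePair.flip ⟨Q, R, τ⟩) (σ p) x).symm

/-- The group `2V`: all bijections of the Cantor square that are represented by some
tree-pair diagram, under composition. -/
def TwoV : Subgroup (Equiv.Perm Square) where
  carrier := {f | ∃ D : TreePair, D.toPerm = f}
  one_mem' := ⟨⟨Tree.leaf, Tree.leaf, Equiv.refl _⟩, rfl⟩
  mul_mem' := by
    rintro _ _ ⟨D, rfl⟩ ⟨E, rfl⟩
    exact exists_toPerm_mul D E
  inv_mem' := by
    rintro _ ⟨D, rfl⟩
    exact ⟨D.flip, rfl⟩

/-- The set `H_n` of elements of `2V` which are represented by a diagram with `n` carets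
and by no diagram with fewer carets. -/
def H (n : ℕ) : Set TwoV :=
  {g | IsLeast {k | ∃ D : TreePair, D.toPerm = g ∧ D.carets = k} n}

/-- The word length of `g` with respect to `S`: the least length of a product of elements
of `S` and inverses of elements of `S` that equals `g` (`⊤` if there is no such product,
which cannot happen if `S` generates the group). -/
noncomputable def wordLength {G : Type*} [Group G] (S : Set G) (g : G) : ℕ∞ :=
  ⨅ w : {w : List G // (∀ s ∈ w, s ∈ S ∨ s⁻¹ ∈ S) ∧ w.prod = g}, (w.1.length : ℕ∞)

end HigherThompson

/-! The ball of radius `n log_{2d} n` is too small to hold a noticeable share of `H n`. There are at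
most `(2d)^k` words of length `k`, so at most `2 n^n` elements satisfy `|g|_S ≤ n log_{2d} n`,
whatever `S` is. On the other side, `H n` has at least `catalan n * n!` elements
(`catalan_mul_factorial_le_ncard_H`). Since `catalan n` is `4^n` up to a polynomial factor and `n^n
≤ e^n n!`, the fraction of short elements is at most a polynomial times `(e/4)^n`.

The lower bound uses only vertical carets: the domain is any binary tree with `n` carets, the range
is the right comb, and the first leaf goes to the last leaf. The words of the comb's leaves are `0,
10, 110, …` and finally `1…1`, so only the last leaf has a word ending in `1`. This forces every
strip on which the map is affine to lie over the interval of a single leaf of the domain tree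
(`AffineOnStrip.exists_prefix`). Hence no diagram of the map, even with horizontal carets, has fewer
carets (`numNodes_le_carets`), and the map determines the tree and the bijection
(`combDiagram_toPerm_injective`). -/

namespace HigherThompson

/-! ### Binary words and the rectangles of leaves -/

/-- Put a finite word in front of a sequence. -/
def prepend (w : List Bool) (x : Cantor) : Cantor := w.foldr cons x

@[simp] theorem prepend_nil (x : Cantor) : prepend [] x = x := rfl

@[simp] theorem prepend_cons (b : Bool) (w : List Bool) (x : Cantor) :
    prepend (b :: w) x = cons b (prepend w x) := rfl

theorem prepend_append (v w : List Bool) (x : Cantor) :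
    prepend (v ++ w) x = prepend v (prepend w x) := List.foldr_append

theorem cons_inj {b c : Bool} {x y : Cantor} (h : cons b x = cons c y) : b = c ∧ x = y :=
  ⟨congrFun h 0, funext fun n => congrFun h (n + 1)⟩

theorem prepend_word_injective {v w : List Bool} (h : ∀ x, prepend v x = prepend w x) :
    v = w := by
  induction v generalizing w with
  | nil =>
    cases w with
    | nil => rfl
    | cons b w =>
      -- The constant sequence of the opposite digit tells a nonempty word from the empty one.
      have := congrFun (h fun _ => !b) 0
      cases b <;> simp [cons] at this
  | cons a v ih =>
    cases w with
    | nil =>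
      have := congrFun (h fun _ => !a) 0
      cases a <;> simp [cons] at this
    | cons b w =>
      rw [ih fun x => (cons_inj (h x)).2, (cons_inj (h fun _ => true)).1]

namespace Tree

/-- The word of the horizontal extent of the rectangle of a leaf. -/
def column : (T : Tree) → T.Leaf → List Bool
  | leaf, _ => []
  | vert l r, a => Sum.elim (fun b => false :: l.column b) (fun b => true :: r.column b) a
  | horiz l r, a => Sum.elim l.column r.column a

/-- The word of the vertical extent of the rectangle of a leaf. -/
def row : (T : Tree) → T.Leaf → List Bool
  | leaf, _ => []
  | vert l r, a => Sum.elim l.row r.row a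
  | horiz l r, a => Sum.elim (fun b => false :: l.row b) (fun b => true :: r.row b) a

theorem partition_apply (T : Tree) (a : T.Leaf) (x : Square) :
    T.partition (a, x) = (prepend (T.column a) x.1, prepend (T.row a) x.2) := by
  induction T with
  | leaf => rfl
  | vert l r hl hr =>
    rcases a with a | a
    · rw [vert_inl, hl]; rfl
    · rw [vert_inr, hr]; rfl
  | horiz l r hl hr =>
    rcases a with a | a
    · rw [horiz_inl, hl]; rfl
    · rw [horiz_inr, hr]; rfl

instance instFiniteLeaf (T : Tree) : Finite T.Leaf := by
  induction T with
  | leaf => exact inferInstanceAs (Finite Unit)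
  | vert l r _ _ => exact inferInstanceAs (Finite (l.Leaf ⊕ r.Leaf))
  | horiz l r _ _ => exact inferInstanceAs (Finite (l.Leaf ⊕ r.Leaf))

theorem card_leaf (T : Tree) : Nat.card T.Leaf = T.carets + 1 := by
  induction T with
  | leaf => exact Nat.card_unique (α := Unit)
  | vert l r hl hr =>
    refine (Nat.card_sum (α := l.Leaf) (β := r.Leaf)).trans ?_
    rw [hl, hr, carets]; omega
  | horiz l r hl hr =>
    refine (Nat.card_sum (α := l.Leaf) (β := r.Leaf)).trans ?_
    rw [hl, hr, carets]; omega

/-- The lower left leaf. -/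
def firstLeaf : (T : Tree) → T.Leaf
  | leaf => ()
  | vert l _ => Sum.inl l.firstLeaf
  | horiz l _ => Sum.inl l.firstLeaf

/-- The upper right leaf. -/
def lastLeaf : (T : Tree) → T.Leaf
  | leaf => ()
  | vert _ r => Sum.inr r.lastLeaf
  | horiz _ r => Sum.inr r.lastLeaf

theorem true_notMem_column_firstLeaf (T : Tree) : true ∉ T.column T.firstLeaf := by
  induction T with
  | leaf => simp [column]
  | vert l r hl _ => simpa [column, firstLeaf] using hl
  | horiz l r hl _ => simpa [column, firstLeaf] using hl

/-! ### Trees with vertical carets only -/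

/-- The tree all of whose carets are vertical, of a given shape. -/
def ofBinary : BinaryTree Unit → Tree
  | .nil => leaf
  | .node _ l r => vert (ofBinary l) (ofBinary r)

theorem carets_ofBinary (t : BinaryTree Unit) : (ofBinary t).carets = t.numNodes := by
  induction t with
  | nil => rfl
  | node a l r hl hr => simp [ofBinary, carets, BinaryTree.numNodes, hl, hr]

theorem row_ofBinary (t : BinaryTree Unit) (a : (ofBinary t).Leaf) : (ofBinary t).row a = [] := by
  induction t with
  | nil => rfl
  | node _ l r hl hr =>
    rcases a with a | a
    · exact hl a
    · exact hr a

theorem partition_ofBinary (t : BinaryTree Unit) (a : (ofBinary t).Leaf) (x y : Cantor) :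
    (ofBinary t).partition (a, (x, y)) = (prepend ((ofBinary t).column a) x, y) := by
  rw [partition_apply, row_ofBinary]; rfl

theorem exists_column_eq_replicate (t : BinaryTree Unit) :
    ∃ a k, (ofBinary t).column a = List.replicate k true := by
  induction t with
  | nil => exact ⟨(), 0, rfl⟩
  | node _ l r _ hr =>
    obtain ⟨a, k, h⟩ := hr
    exact ⟨Sum.inr a, k + 1, congrArg (true :: ·) h⟩

/-- A word is either inside the interval of a leaf, or the interval of some leaf lies at its
right end. -/
theorem exists_column_prefix_or (t : BinaryTree Unit) (w : List Bool) :
    (∃ a, (ofBinary t).column a <+: w) ∨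
      ∃ a k, (ofBinary t).column a = w ++ List.replicate (k + 1) true := by
  induction t generalizing w with
  | nil => exact Or.inl ⟨(), List.nil_prefix⟩
  | node _ l r hl hr =>
    rcases w with _ | ⟨_ | _, w⟩
    · obtain ⟨a, k, h⟩ := exists_column_eq_replicate r
      exact Or.inr ⟨Sum.inr a, k, congrArg (true :: ·) h⟩
    · rcases hl w with ⟨a, h⟩ | ⟨a, k, h⟩
      · exact Or.inl ⟨Sum.inl a, List.cons_prefix_cons.2 ⟨rfl, h⟩⟩
      · exact Or.inr ⟨Sum.inl a, k, congrArg (false :: ·) h⟩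
    · rcases hr w with ⟨a, h⟩ | ⟨a, k, h⟩
      · exact Or.inl ⟨Sum.inr a, List.cons_prefix_cons.2 ⟨rfl, h⟩⟩
      · exact Or.inr ⟨Sum.inr a, k, congrArg (true :: ·) h⟩

/-- Antisymmetry of refinement: comparing first digits passes both hypotheses on to the left and to
the right subtrees. -/
theorem eq_of_column_prefix {s t : BinaryTree Unit}
    (hst : ∀ a, ∃ b, (ofBinary t).column b <+: (ofBinary s).column a)
    (hts : ∀ b, ∃ a, (ofBinary s).column a <+: (ofBinary t).column b) : s = t := by
  induction s generalizing t with
  | nil =>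
    cases t with
    | nil => rfl
    | node _ l r =>
      obtain ⟨b | b, h⟩ := hst ()
      · exact absurd (List.prefix_nil.1 h) (List.cons_ne_nil _ _)
      · exact absurd (List.prefix_nil.1 h) (List.cons_ne_nil _ _)
  | node _ l r hl hr =>
    cases t with
    | nil =>
      obtain ⟨b | b, h⟩ := hts ()
      · exact absurd (List.prefix_nil.1 h) (List.cons_ne_nil _ _)
      · exact absurd (List.prefix_nil.1 h) (List.cons_ne_nil _ _)
    | node _ l' r' =>
      have left : ∀ {l r l' r' : BinaryTree Unit}
          (_ : ∀ a, ∃ b, (ofBinary (.node () l' r')).column b <+: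
            (ofBinary (.node () l r)).column a),
          ∀ a, ∃ b, (ofBinary l').column b <+: (ofBinary l).column a := by
        intro l r l' r' h a
        obtain ⟨b | b, hb⟩ := h (Sum.inl a)
        · exact ⟨b, (List.cons_prefix_cons.1 hb).2⟩
        · exact absurd (List.cons_prefix_cons.1 hb).1 (by decide)
      have right : ∀ {l r l' r' : BinaryTree Unit}
          (_ : ∀ a, ∃ b, (ofBinary (.node () l' r')).column b <+:
            (ofBinary (.node () l r)).column a),
          ∀ a, ∃ b, (ofBinary r').column b <+: (ofBinary r).column a := by
        intro l r l' r' h a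
        obtain ⟨b | b, hb⟩ := h (Sum.inr a)
        · exact absurd (List.cons_prefix_cons.1 hb).1 (by decide)
        · exact ⟨b, (List.cons_prefix_cons.1 hb).2⟩
      rw [hl (left hst) (left hts), hr (right hst) (right hts)]

/-- The shape of the tree whose carets lie along the right edge. -/
def rightComb : ℕ → BinaryTree Unit
  | 0 => .nil
  | n + 1 => .node () .nil (rightComb n)

theorem numNodes_rightComb (n : ℕ) : (rightComb n).numNodes = n := by
  induction n with
  | zero => rfl
  | succ n ih => simp [rightComb, BinaryTree.numNodes, ih]

/-- Every leaf of the comb but the last is a left child, so its word ends in `false`. -/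
theorem eq_lastLeaf_of_column_eq {n : ℕ} {c : (ofBinary (rightComb n)).Leaf} {u : List Bool}
    (h : (ofBinary (rightComb n)).column c = u ++ [true]) : c = lastLeaf _ := by
  induction n generalizing u with
  | zero => rfl
  | succ n ih =>
    rcases c with c | c
    · change [false] = u ++ [true] at h
      rcases u with _ | ⟨_, _ | _⟩ <;> simp at h
    · change true :: (ofBinary (rightComb n)).column c = u ++ [true] at h
      rcases u with _ | ⟨b, u⟩
      · cases n with
        | zero => rfl
        | succ n => rcases c with c | c <;> exact absurd (List.cons.inj h).2 (List.cons_ne_nil _ _)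
      · exact congrArg Sum.inr (ih (List.cons.inj h).2)

theorem finite_setOf_carets_le (n : ℕ) : {T : Tree | T.carets ≤ n}.Finite := by
  induction n with
  | zero =>
    refine (Set.finite_singleton leaf).subset ?_
    rintro (_ | ⟨l, r⟩ | ⟨l, r⟩) h
    · rfl
    · simp [carets] at h
    · simp [carets] at h
  | succ n ih =>
    refine ((Set.finite_singleton leaf).union
      ((ih.image2 vert ih).union (ih.image2 horiz ih))).subset ?_
    rintro (_ | ⟨l, r⟩ | ⟨l, r⟩) h
    · exact Or.inl rfl
    · simp only [Set.mem_ofPred_eq, carets] at h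
      exact Or.inr (Or.inl ⟨l, by simp; omega, r, by simp; omega, rfl⟩)
    · simp only [Set.mem_ofPred_eq, carets] at h
      exact Or.inr (Or.inr ⟨l, by simp; omega, r, by simp; omega, rfl⟩)

end Tree

open HigherThompson.Tree

/-! ### Finiteness of `H n` -/

theorem TreePair.carets_range (D : TreePair) : D.range.carets = D.domain.carets := by
  have := Nat.card_congr D.perm
  rw [card_leaf, card_leaf] at this
  omega

theorem TreePair.finite_setOf_carets_eq (n : ℕ) : {D : TreePair | D.carets = n}.Finite := by
  have h := finite_setOf_carets_le n
  refine ((h.prod h).biUnion fun p _ =>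
    Set.finite_range fun e : p.1.Leaf ≃ p.2.Leaf => TreePair.mk p.1 p.2 e).subset ?_
  intro D hD
  have h1 : D.domain.carets = n := hD
  exact Set.mem_biUnion (x := (D.domain, D.range))
    ⟨h1.le, (D.carets_range.trans h1).le⟩ ⟨D.perm, rfl⟩

theorem finite_H (n : ℕ) : (H n).Finite := by
  refine Set.Finite.of_finite_image (f := Subtype.val)
    (((TreePair.finite_setOf_carets_eq n).image TreePair.toPerm).subset ?_)
    Subtype.val_injective.injOn
  rintro _ ⟨g, hg, rfl⟩
  obtain ⟨D, hD, hn⟩ := hg.1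
  exact ⟨D, hn, hD⟩

/-! ### Minimality and uniqueness of the comb diagrams -/

/-- The map is affine on the vertical strip over the interval of `w`, and the identity on
the second coordinate. -/
def AffineOnStrip (f : Equiv.Perm Square) (w : List Bool) : Prop :=
  ∃ u, ∀ x y, f (prepend w x, y) = (prepend u x, y)

/-- The diagram with vertical carets and a right comb as range. -/
def combDiagram (t : BinaryTree Unit) (n : ℕ)
    (σ : (ofBinary t).Leaf ≃ (ofBinary (rightComb n)).Leaf) : TreePair :=
  ⟨ofBinary t, ofBinary (rightComb n), σ⟩

section combDiagram

variable {t : BinaryTree Unit} {n : ℕ} {σ : (ofBinary t).Leaf ≃ (ofBinary (rightComb n)).Leaf}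

theorem combDiagram_apply (a : (ofBinary t).Leaf) (x y : Cantor) :
    (combDiagram t n σ).toPerm (prepend ((ofBinary t).column a) x, y) =
      (prepend ((ofBinary (rightComb n)).column (σ a)) x, y) := by
  rw [← partition_ofBinary, ← partition_ofBinary]
  exact toPerm_apply (combDiagram t n σ) a (x, y)

theorem affineOnStrip_column (a : (ofBinary t).Leaf) :
    AffineOnStrip (combDiagram t n σ).toPerm ((ofBinary t).column a) :=
  ⟨_, combDiagram_apply a⟩

theorem combDiagram_apply_mk (x y z : Cantor) :
    (combDiagram t n σ).toPerm (x, y) = (((combDiagram t n σ).toPerm (x, z)).1, y) := by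
  obtain ⟨⟨a, x', y'⟩, h⟩ := (ofBinary t).partition.surjective (x, y)
  rw [partition_ofBinary, Prod.mk.injEq] at h
  rw [← h.1, combDiagram_apply, combDiagram_apply]

/-- Otherwise some leaf `a` lies at the right end of the strip, with word `w` followed by ones.
Affinity makes the word of `σ a` end in `true` too, so `σ a` is the last leaf and `a` the first,
whose word contains no `true`. -/
theorem AffineOnStrip.exists_prefix (hσ : σ (firstLeaf _) = lastLeaf _) {w : List Bool}
    (h : AffineOnStrip (combDiagram t n σ).toPerm w) : ∃ a, (ofBinary t).column a <+: w := by
  refine (exists_column_prefix_or t w).resolve_right ?_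
  rintro ⟨a, k, ha⟩
  obtain ⟨u, hu⟩ := h
  have key : (ofBinary (rightComb n)).column (σ a) = u ++ List.replicate (k + 1) true := by
    refine prepend_word_injective fun x => ?_
    have := combDiagram_apply (σ := σ) a x x
    rw [ha, prepend_append, hu, ← prepend_append] at this
    exact (congrArg Prod.fst this).symm
  rw [List.replicate_succ', ← List.append_assoc] at key
  have := eq_lastLeaf_of_column_eq key
  rw [← hσ, σ.injective.eq_iff] at this
  subst this
  exact true_notMem_column_firstLeaf (ofBinary t) (by rw [ha]; simp)

/-- Each rectangle of `E.domain` lies over the interval of one leaf of `t`. Sending a leaf of `t` to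
the rectangle that contains a chosen point of its strip is therefore injective. -/
theorem numNodes_le_carets (hσ : σ (firstLeaf _) = lastLeaf _) {E : TreePair}
    (hE : E.toPerm = (combDiagram t n σ).toPerm) : t.numNodes ≤ E.carets := by
  let x₀ : Square := (fun _ => false, fun _ => false)
  have affine : ∀ p : E.domain.Leaf,
      AffineOnStrip (combDiagram t n σ).toPerm (E.domain.column p) := by
    intro p
    refine ⟨E.range.column (E.perm p), fun x y => ?_⟩
    have := toPerm_apply E p (x, x₀.2)
    rw [partition_apply, partition_apply, hE] at this
    -- The image's first coordinate ignores the height, so affinity on the rectangle of `p` extends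
    -- to its full strip.
    rw [combDiagram_apply_mk _ _ (prepend (E.domain.row p) x₀.2), this]
  have inj : Function.Injective fun a : (ofBinary t).Leaf =>
      (E.domain.partition.symm ((ofBinary t).partition (a, x₀))).1 := by
    -- The chosen point of `a` lies in `p`, hence over the interval of `b`; the strips of distinct
    -- leaves are disjoint.
    have key : ∀ (a : (ofBinary t).Leaf) p,
        (E.domain.partition.symm ((ofBinary t).partition (a, x₀))).1 = p →
        ∀ b, (ofBinary t).column b <+: E.domain.column p → b = a := by
      rintro a p rfl b ⟨v, hb⟩
      set q := E.domain.partition.symm ((ofBinary t).partition (a, x₀)) with hq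
      have h : E.domain.partition (q.1, q.2) = (ofBinary t).partition (a, x₀) := by simp [hq]
      rw [partition_apply, ← hb, prepend_append, ← partition_ofBinary] at h
      exact congrArg Prod.fst ((ofBinary t).partition.injective h)
    intro a a' h
    obtain ⟨b, hb⟩ := (affine _).exists_prefix hσ
    exact (key a _ h b hb).symm.trans (key a' _ rfl b hb)
  have := Nat.card_le_card_of_injective _ inj
  rw [card_leaf, card_leaf, carets_ofBinary] at this
  exact Nat.le_of_succ_le_succ this

end combDiagram

/-- The map is affine over each leaf of either tree, so the two trees refine each other. -/
theorem combDiagram_toPerm_injective {s t : BinaryTree Unit} {n : ℕ}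
    {σ : (ofBinary s).Leaf ≃ (ofBinary (rightComb n)).Leaf}
    {τ : (ofBinary t).Leaf ≃ (ofBinary (rightComb n)).Leaf}
    (hσ : σ (firstLeaf _) = lastLeaf _) (hτ : τ (firstLeaf _) = lastLeaf _)
    (h : (combDiagram s n σ).toPerm = (combDiagram t n τ).toPerm) : s = t ∧ HEq σ τ := by
  have : s = t := eq_of_column_prefix
    (fun a => (h ▸ affineOnStrip_column (σ := σ) a).exists_prefix hτ)
    (fun b => (h ▸ affineOnStrip_column (σ := τ) b).exists_prefix hσ)
  subst this
  refine ⟨rfl, heq_of_eq (Equiv.ext fun a => ?_)⟩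
  let x₀ : Square := (fun _ => false, fun _ => false)
  have h1 := toPerm_apply (combDiagram s n σ) a x₀
  rw [h] at h1
  have h2 := h1.symm.trans (toPerm_apply (combDiagram s n τ) a x₀)
  exact congrArg Prod.fst ((ofBinary (rightComb n)).partition.injective h2)

theorem combDiagram_mem_H {t : BinaryTree Unit} {n : ℕ} (ht : t.numNodes = n)
    {σ : (ofBinary t).Leaf ≃ (ofBinary (rightComb n)).Leaf} (hσ : σ (firstLeaf _) = lastLeaf _) :
    (⟨(combDiagram t n σ).toPerm, _, rfl⟩ : TwoV) ∈ H n := by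
  refine ⟨⟨_, rfl, (carets_ofBinary t).trans ht⟩, ?_⟩
  rintro _ ⟨E, hE, rfl⟩
  exact ht ▸ numNodes_le_carets hσ hE

/-! ### Lower bound for the size of `H n` -/

theorem exists_leaf_equiv_option (T : Tree) (a : T.Leaf) :
    ∃ e : T.Leaf ≃ Option (Fin T.carets), e a = none := by
  classical
  have h : Nat.card {b : T.Leaf // b ≠ a} = T.carets := by
    have := Nat.card_congr (Equiv.optionSubtypeNe a)
    rw [Finite.card_option, card_leaf] at this
    omega
  refine ⟨(Equiv.optionSubtypeNe a).symm.trans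
    (Equiv.optionCongr (Finite.equivFinOfCardEq h)), ?_⟩
  simp

theorem catalan_mul_factorial_le_ncard_H (n : ℕ) : catalan n * n.factorial ≤ (H n).ncard := by
  classical
  have hd : ∀ t : BinaryTree Unit, t.numNodes = n →
      ∃ e : (ofBinary t).Leaf ≃ Option (Fin n), e (firstLeaf _) = none := by
    rintro t rfl
    rw [← carets_ofBinary]
    exact exists_leaf_equiv_option _ _
  have hr : ∃ e : (ofBinary (rightComb n)).Leaf ≃ Option (Fin n), e (lastLeaf _) = none := by
    have := exists_leaf_equiv_option (ofBinary (rightComb n)) (lastLeaf _)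
    rwa [carets_ofBinary, numNodes_rightComb] at this
  choose d hd using hd
  obtain ⟨e, he⟩ := hr
  let X := {t : BinaryTree Unit // t ∈ BinaryTree.treesOfNumNodesEq n}
  have hX : ∀ t : X, t.1.numNodes = n := fun t => BinaryTree.mem_treesOfNumNodesEq.1 t.2
  -- The label `none` marks the first leaf of the domain and the last leaf of the comb; the other
  -- `n` leaves are permuted freely, which gives the factor `n!`.
  let σ (p : X × Equiv.Perm (Fin n)) :
      (ofBinary p.1.1).Leaf ≃ (ofBinary (rightComb n)).Leaf :=
    (d p.1.1 (hX p.1)).trans ((Equiv.optionCongr p.2).trans e.symm)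
  have hσ : ∀ p, σ p (firstLeaf _) = lastLeaf _ := by
    intro p
    simp [σ, hd, Equiv.symm_apply_eq, he]
  let F (p : X × Equiv.Perm (Fin n)) : H n :=
    ⟨_, combDiagram_mem_H (hX p.1) (hσ p)⟩
  have hF : Function.Injective F := by
    rintro ⟨⟨s, hs⟩, α⟩ ⟨⟨t, ht⟩, β⟩ h
    have h' := congrArg (fun g : H n => (g.1 : Equiv.Perm Square)) h
    obtain ⟨h1, h2⟩ := combDiagram_toPerm_injective (hσ (⟨s, hs⟩, α)) (hσ (⟨t, ht⟩, β)) h'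
    dsimp only at h1
    subst h1
    have h3 := eq_of_heq h2
    have h4 : Equiv.optionCongr α = Equiv.optionCongr β := by
      ext1 z
      have := congrArg (fun f => e (f ((d s (hX ⟨s, hs⟩)).symm z))) h3
      simpa [σ] using this
    rw [Equiv.optionCongr_injective h4]
  have := (finite_H n).to_subtype
  have h := Nat.card_le_card_of_injective F hF
  rw [Nat.card_prod, Nat.card_perm, Nat.card_fin, Nat.card_coe_set_eq] at h
  refine le_trans (le_of_eq ?_) h
  rw [Nat.card_eq_fintype_card, Fintype.card_coe, BinaryTree.treesOfNumNodesEq_card_eq_catalan]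

/-! ### Upper bound for the number of short elements -/

theorem sum_pow_le_two_mul_pow {m L : ℕ} (h : 2 ≤ m ∨ L = 0) :
    ∑ k ∈ Finset.range (L + 1), m ^ k ≤ 2 * m ^ L := by
  obtain h | rfl := h
  · induction L with
    | zero => simp
    | succ L ih =>
      rw [Finset.sum_range_succ]
      have : 2 * m ^ L ≤ m ^ (L + 1) := by
        rw [pow_succ, mul_comm]; exact Nat.mul_le_mul_left _ h
      omega
  · simp

/-- The number of group elements given by words of length at most `L`. -/
theorem exists_finset_wordLength_le {G : Type*} [Group G] (S : Finset G) (L : ℕ) :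
    ∃ B : Finset G, (∀ g, wordLength (S : Set G) g ≤ L → g ∈ B) ∧
      B.card ≤ ∑ k ∈ Finset.range (L + 1), (2 * S.card) ^ k := by
  classical
  let W (k : ℕ) : Finset G :=
    (Finset.univ : Finset (Fin k → S × Bool)).image
      fun w => (List.ofFn fun i => cond (w i).2 ((w i).1 : G) ((w i).1 : G)⁻¹).prod
  have hW : ∀ k, (W k).card ≤ (2 * S.card) ^ k := fun k => by
    refine Finset.card_image_le.trans (le_of_eq ?_)
    simp [mul_comm]
  refine ⟨(Finset.range (L + 1)).biUnion W, fun g hg => ?_,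
    Finset.card_biUnion_le.trans (Finset.sum_le_sum fun k _ => hW k)⟩
  unfold wordLength at hg
  cases isEmpty_or_nonempty {w : List G // (∀ s ∈ w, s ∈ (S : Set G) ∨ s⁻¹ ∈ (S : Set G)) ∧
      w.prod = g} with
  | inl h => simp [iInf_of_empty] at hg
  | inr h =>
    obtain ⟨⟨w, hw, hwg⟩, hmin⟩ := ENat.exists_eq_iInf
      fun w : {w : List G // (∀ s ∈ w, s ∈ (S : Set G) ∨ s⁻¹ ∈ (S : Set G)) ∧ w.prod = g} =>
        (w.1.length : ℕ∞)
    rw [← hmin] at hg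
    have hlen : w.length ≤ L := by exact_mod_cast hg
    have hc : ∀ i : Fin w.length, ∃ p : S × Bool,
        cond p.2 (p.1 : G) (p.1 : G)⁻¹ = w.get i := by
      intro i
      rcases hw _ (w.get_mem i) with h | h
      · exact ⟨(⟨_, h⟩, true), rfl⟩
      · exact ⟨(⟨_, h⟩, false), inv_inv _⟩
    choose p hp using hc
    refine Finset.mem_biUnion.2 ⟨w.length, Finset.mem_range.2 (Nat.lt_succ_of_le hlen),
      Finset.mem_image.2 ⟨p, Finset.mem_univ _, ?_⟩⟩
    simp only [hp, List.ofFn_get, hwg]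

theorem mul_logb_nonneg (d n : ℕ) : 0 ≤ (n : ℝ) * Real.logb (2 * d) n := by
  rcases Nat.eq_zero_or_pos d with rfl | hd
  · simp [Real.logb]
  rcases Nat.eq_zero_or_pos n with rfl | hn
  · simp
  have hd' : (1 : ℝ) ≤ d := by exact_mod_cast hd
  have hn' : (1 : ℝ) ≤ n := by exact_mod_cast hn
  exact mul_nonneg n.cast_nonneg (Real.logb_nonneg (by linarith) hn')

/-- For positive `d` and `n` this is `(2d)^(n log_{2d} n) = n^n`. If `d = 0` or `n = 0` the exponent
is `0`, and `n^n ≥ 1` because `0^0 = 1`. -/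
theorem pow_floor_mul_logb_le (d n : ℕ) :
    (2 * d) ^ ⌊(n : ℝ) * Real.logb (2 * d) n⌋₊ ≤ n ^ n := by
  have hpos : 1 ≤ n ^ n := Nat.pow_self_pos
  rcases Nat.eq_zero_or_pos d with rfl | hd
  · simpa [Real.logb] using hpos
  rcases Nat.eq_zero_or_pos n with rfl | hn
  · simp
  have hd' : (1 : ℝ) ≤ d := by exact_mod_cast hd
  have hn' : (0 : ℝ) < n := by exact_mod_cast hn
  have h : ((2 * d : ℝ)) ^ ⌊(n : ℝ) * Real.logb (2 * d) n⌋₊ ≤ (n : ℝ) ^ n := by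
    rw [← Real.rpow_natCast]
    calc _ ≤ (2 * d : ℝ) ^ ((n : ℝ) * Real.logb (2 * d) n) :=
          Real.rpow_le_rpow_of_exponent_le (by linarith) (Nat.floor_le (mul_logb_nonneg d n))
      _ = (n : ℝ) ^ n := by
          rw [mul_comm (n : ℝ), Real.rpow_mul (by linarith), Real.rpow_logb (by linarith) (by linarith) hn',
            Real.rpow_natCast]
  exact_mod_cast h

theorem ncard_not_lt_wordLength_le {G : Type*} [Group G] (S : Finset G) (n : ℕ) (A : Set G) :
    {g ∈ A | ¬ ((n * Real.logb (2 * S.card) n : ℝ) : EReal) <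
      ((wordLength (S : Set G) g : ENNReal) : EReal)}.ncard ≤ 2 * n ^ n := by
  set L := ⌊(n : ℝ) * Real.logb (2 * S.card) n⌋₊ with hL
  have hfin : ∀ g : G, ¬ ((n * Real.logb (2 * S.card) n : ℝ) : EReal) <
      ((wordLength (S : Set G) g : ENNReal) : EReal) → wordLength (S : Set G) g ≤ L := by
    intro g hg
    rw [not_lt] at hg
    generalize wordLength (S : Set G) g = k at hg
    induction k using ENat.recTopCoe with
    -- Elements that are not products over `S` count as long.
    | top => exact absurd (top_le_iff.1 hg) (EReal.coe_ne_top _)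
    | coe k =>
      have hk : ((k : ℝ) : EReal) ≤ ((n * Real.logb (2 * S.card) n : ℝ) : EReal) := by
        exact hg
      exact Nat.cast_le.2 (Nat.le_floor (EReal.coe_le_coe_iff.1 hk))
  obtain ⟨B, hB, hcard⟩ := exists_finset_wordLength_le S L
  calc _ ≤ (B : Set G).ncard := Set.ncard_le_ncard (fun g hg => hB g (hfin g hg.2)) B.finite_toSet
    _ ≤ _ := (Set.ncard_coe_finset B).le.trans hcard
    _ ≤ 2 * (2 * S.card) ^ L := by
        refine sum_pow_le_two_mul_pow ?_
        rcases Nat.eq_zero_or_pos S.card with h | h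
        -- For empty `S` the base is `0` and `Real.log 0 = 0`, so `L = 0`.
        · right; simp [hL, h, Real.logb]
        · left; omega
    _ ≤ _ := Nat.mul_le_mul_left 2 (pow_floor_mul_logb_le S.card n)

/-! ### Comparison of `n^n` with `catalan n * n!` -/

theorem two_mul_pow_self_le (n : ℕ) :
    (2 * n ^ n : ℝ) ≤ 4 * (n + 1) ^ 2 * (68 / 100) ^ n * (catalan n * n.factorial : ℕ) := by
  have hc : (4 : ℝ) ^ n ≤ 2 * (n + 1) ^ 2 * catalan n := by
    have h := Nat.four_pow_le_two_mul_add_one_mul_central_binom n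
    have h' : n.centralBinom = (2 * n).choose n := rfl
    rw [← h', ← succ_mul_catalan_eq_centralBinom] at h
    have h2 : (4 : ℝ) ^ n ≤ (2 * n + 1) * ((n + 1) * catalan n) := by exact_mod_cast h
    nlinarith [mul_nonneg (by positivity : (0 : ℝ) ≤ n + 1) (Nat.cast_nonneg (α := ℝ) (catalan n))]
  -- `n^n / n!` is one term of the series of `e^n`, and `e < 2.72 = 0.68 * 4`.
  have hf : (n : ℝ) ^ n ≤ 2.72 ^ n * n.factorial := by
    have h := Real.pow_div_factorial_le_exp (n : ℝ) n.cast_nonneg n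
    rw [div_le_iff₀ (by positivity)] at h
    refine h.trans (mul_le_mul_of_nonneg_right ?_ (by positivity))
    rw [← mul_one (n : ℝ), Real.exp_nat_mul]
    exact pow_le_pow_left₀ (Real.exp_pos 1).le (by linarith [Real.exp_one_lt_d9]) n
  have e : (2.72 : ℝ) ^ n = (68 / 100) ^ n * 4 ^ n := by rw [← mul_pow]; norm_num
  push_cast
  calc (2 * n ^ n : ℝ) ≤ 2 * ((68 / 100) ^ n * (2 * (n + 1) ^ 2 * catalan n) * n.factorial) := by
        rw [e] at hf
        refine mul_le_mul_of_nonneg_left (hf.trans ?_) zero_le_two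
        gcongr
    _ = _ := by ring

theorem exists_sq_mul_pow_le : ∃ C : ℝ, 0 < C ∧
    ∀ n : ℕ, 4 * ((n : ℝ) + 1) ^ 2 * (68 / 100) ^ n ≤ C * (7 / 10) ^ n := by
  have h := tendsto_pow_const_mul_const_pow_of_abs_lt_one 2
    (r := (68 / 70 : ℝ)) (by rw [abs_of_pos] <;> norm_num)
  obtain ⟨B, hB⟩ := h.bddAbove_range
  have hB' : ∀ n : ℕ, (n : ℝ) ^ 2 * (68 / 70) ^ n ≤ B := fun n => hB ⟨n, rfl⟩
  have hB0 : 0 ≤ B := by simpa using hB' 0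
  -- The bound `B` is used at `n + 1`, which costs the factor `70 / 68`; the `+ 1` keeps the
  -- constant positive.
  refine ⟨4 * (B * (70 / 68)) + 1, by positivity, fun n => ?_⟩
  have e : (68 / 100 : ℝ) ^ n = (68 / 70) ^ n * (7 / 10) ^ n := by rw [← mul_pow]; norm_num
  have hn := hB' (n + 1)
  push_cast [pow_succ (68 / 70 : ℝ) n] at hn
  rw [e, ← mul_assoc]
  refine mul_le_mul_of_nonneg_right ?_ (by positivity)
  linarith

end HigherThompson

open HigherThompson in
theorem theorem4p2 :
    (∀ n : ℕ, (H n).Finite ∧ (H n).Nonempty) ∧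
    ∃ C r : ℝ, 0 < C ∧ 0 < r ∧ r < 1 ∧
      ∀ (S : Finset TwoV) (n : ℕ),
        |(({g ∈ H n | ((n * Real.logb (2 * S.card) n : ℝ) : EReal) <
              ((wordLength (S : Set TwoV) g : ENNReal) : EReal)}.ncard : ℝ) /
            ((H n).ncard : ℝ)) - 1| ≤ C * r ^ n := by
  have hpos : ∀ n, 0 < (H n).ncard := fun n => by
    refine lt_of_lt_of_le (Nat.mul_pos ?_ n.factorial_pos) (catalan_mul_factorial_le_ncard_H n)
    exact Nat.pos_of_mul_pos_left (succ_mul_catalan_eq_centralBinom n ▸ n.centralBinom_pos)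
  refine ⟨fun n => ⟨finite_H n, Set.nonempty_of_ncard_ne_zero (hpos n).ne'⟩, ?_⟩
  obtain ⟨C, hC, hbound⟩ := exists_sq_mul_pow_le
  refine ⟨C, 7 / 10, hC, by norm_num, by norm_num, fun S n => ?_⟩
  set p : TwoV → Prop := fun g => ((n * Real.logb (2 * S.card) n : ℝ) : EReal) <
    ((wordLength (S : Set TwoV) g : ENNReal) : EReal)
  have hn : (0 : ℝ) < (H n).ncard := by exact_mod_cast hpos n
  -- The quantity to bound thus becomes the fraction of short elements.
  have hsplit : {g ∈ H n | p g}.ncard + {g ∈ H n | ¬ p g}.ncard = (H n).ncard := by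
    rw [← Set.ncard_union_eq (Set.disjoint_left.2 fun g h h' => h'.2 h.2)
      ((finite_H n).subset fun g h => h.1) ((finite_H n).subset fun g h => h.1)]
    congr 1
    ext g
    by_cases h : p g <;> simp [h]
  have hsplit' : ({g ∈ H n | p g}.ncard : ℝ) = (H n).ncard - {g ∈ H n | ¬ p g}.ncard := by
    rw [← hsplit]; push_cast; ring
  rw [hsplit', sub_div, div_self hn.ne', sub_sub_cancel_left, abs_neg,
    abs_of_nonneg (by positivity), div_le_iff₀ hn]
  calc ({g ∈ H n | ¬ p g}.ncard : ℝ) ≤ (2 * n ^ n : ℝ) := by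
        exact (Nat.cast_le.2 (ncard_not_lt_wordLength_le S n (H n))).trans_eq (by push_cast; rfl)
    _ ≤ _ := two_mul_pow_self_le n
    _ ≤ C * (7 / 10) ^ n * (H n).ncard :=
        mul_le_mul (hbound n) (by exact_mod_cast catalan_mul_factorial_le_ncard_H n)
          (by positivity) (by positivity)
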